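/- Let $\boldsymbol\alpha=(\alpha_j)_{j\in\mathbb Z}$ be a finitely supported real mask and let $\mathcal S_{\boldsymbol\alpha}(\boldsymbol c)_j=\sum_{k\in\mathbb Z}\alpha_{j-2k}c_k$ be the associated linear univariate subdivision scheme, acting on real sequences $\boldsymbol c=(c_k)_{k\in\mathbb Z}$. The scheme is called convergent if for every real sequence $\boldsymbol c$ there is a continuous function $f:\mathbb R\to\mathbb R$ such that, for every closed bounded interval $I$, $\sup_{j\in\mathbb Z\cap 2^nI}|\mathcal S_{\boldsymbol\alpha}^n(\boldsymbol c)_j-f(2^{-n}j)|\to0$ as $n\to\infty$, and if $f\not\equiv0$ for at least one $\boldsymbol c$. For $\xi>0$, let $\widetilde{\boldsymbol\alpha}=\widetilde{\boldsymbol\alpha}(\xi)$ be the following approximating mask. Its odd elements are those of $\boldsymbol\alpha$: $\widetilde\alpha_{2k+1}=\alpha_{2k+1}$. Its even elements are the coefficients of the Laurent polynomial $\sum_{k}\widetilde\alpha_{2k}z^k$ obtained from the symbol $(\boldsymbol\alpha\downarrow2)(z)=\sum_k\alpha_{2k}z^k$ by replacing each zero $r$ with $|r|=1$ by $(1+\xi)r$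 (counting multiplicities), keeping all other zeros, and normalizing so that the value at $z=1$ is $1$. That is, if $(\boldsymbol\alpha\downarrow2)(z)=z^{-N}p(z)$ with a polynomial $p$ whose multiset of complex zeros is $\Lambda$, then $$\sum_{k}\widetilde\alpha_{2k}z^k=z^{-N}\,C_\xi\prod_{r\in\Lambda,\ |r|\ne1}(z-r)\prod_{r\in\Lambda,\ |r|=1}\bigl(z-(1+\xi)r\bigr),$$ where the constant $C_\xi$ is chosen so that the right-hand side equals $1$ at $z=1$. (This does not depend on the choice of $N$, and $\widetilde{\boldsymbol\alpha}$ is again real and finitely supported.) If $\mathcal S_{\boldsymbol\alpha}$ is convergent, then there is $\xi_0>0$ such that $\mathcal S_{\widetilde{\boldsymbol\alpha}(\xi)}$ is convergent for every $\xi\in(0,\xi_0)$. -/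

import Mathlib

open Polynomial

noncomputable section

namespace Subdivision

/-- The polynomial `∏_{r ∈ Λ \ 𝕋} (z - r) * ∏_{r ∈ Λ ∩ 𝕋} (z - (1 + ξ) r)`, where `Λ` is the multiset
of zeros of `p` and `𝕋` is the unit circle. -/
def displaced (p : ℂ[X]) (ξ : ℝ) : ℂ[X] :=
  (p.roots.map fun r : ℂ => X - C (if ‖r‖ = 1 then (1 + (ξ : ℂ)) * r else r)).prod

/-- The reversible approximation of `p` with parameter `ξ` (the reciprocal of the pseudo-reverse of
`p`): the zeros of `p` of modulus one are multiplied by `1 + ξ`, and the leading constant is chosen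
such that the value at `1` is `1`. -/
def approxPoly (p : ℂ[X]) (ξ : ℝ) : ℂ[X] :=
  C ((displaced p ξ).eval 1)⁻¹ * displaced p ξ

/-- The even elements `α ↓ 2` of a mask. -/
def evenPart (α : ℤ →₀ ℝ) : ℤ →₀ ℝ :=
  α.comapDomain (fun k : ℤ => 2 * k) (fun _ _ _ _ h => by simpa using h)

/-- A power `N` such that `z ^ N * ∑ k, a k * z ^ k` is a polynomial in `z`. -/
def shiftExp (a : ℤ →₀ ℝ) : ℕ := a.support.sup Int.natAbs

/-- The symbol `∑ k, a k * z ^ k` (a Laurent polynomial) multiplied by `z ^ N`, `N = shiftExp a`. -/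
def symbolPoly (a : ℤ →₀ ℝ) : ℝ[X] :=
  ∑ k ∈ a.support, monomial (k + shiftExp a).toNat (a k)

/-- The complex coefficient of `z ^ k` in the reversible approximation of the symbol of `a`.
The symbol is multiplied by `z ^ N` to make it a polynomial, and the result is divided by `z ^ N`
again; this only adds or removes zeros at the origin, which the approximation does not move. -/
def approxCoeff (a : ℤ →₀ ℝ) (ξ : ℝ) (k : ℤ) : ℂ :=
  if 0 ≤ k + shiftExp a then
    (approxPoly ((symbolPoly a).map (algebraMap ℝ ℂ)) ξ).coeff (k + shiftExp a).toNat
  else 0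

lemma displaced_map_conj (p : ℝ[X]) (ξ : ℝ) :
    (displaced (p.map (algebraMap ℝ ℂ)) ξ).map (starRingEnd ℂ) =
      displaced (p.map (algebraMap ℝ ℂ)) ξ := by
  set q := p.map (algebraMap ℝ ℂ) with hq
  have hqc : q.map (starRingEnd ℂ) = q := by
    rw [hq, Polynomial.map_map]
    congr 1
    ext x
    simp
  have hroots : q.roots.map (starRingEnd ℂ) = q.roots := by
    have h := Polynomial.roots_map_of_injective_of_card_eq_natDegree
      (p := q) (f := starRingEnd ℂ) (RingHom.injective _)
      IsAlgClosed.card_roots_eq_natDegree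
    rwa [hqc] at h
  unfold displaced
  rw [← Polynomial.coe_mapRingHom, map_multiset_prod, Multiset.map_map]
  conv_rhs => rw [← hroots, Multiset.map_map]
  congr 1
  apply Multiset.map_congr rfl
  intro r _
  by_cases h : ‖r‖ = 1 <;> simp [h]

/-- The coefficients of the approximation of a real symbol are real, so that the real part taken in
`approxMask` loses nothing. -/
theorem approxCoeff_im (a : ℤ →₀ ℝ) (ξ : ℝ) (k : ℤ) : (approxCoeff a ξ k).im = 0 := by
  unfold approxCoeff
  split_ifs with h
  · have hd := displaced_map_conj (symbolPoly a) ξ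
    set d := displaced ((symbolPoly a).map (algebraMap ℝ ℂ)) ξ with hdd
    have hc : ∀ n, starRingEnd ℂ (d.coeff n) = d.coeff n := fun n => by
      conv_rhs => rw [← hd]
      simp
    have he : starRingEnd ℂ (d.eval 1) = d.eval 1 := by
      have := Polynomial.eval_map_apply (starRingEnd ℂ) (p := d) 1
      rw [hd, map_one] at this
      exact this.symm
    unfold approxPoly
    rw [← Complex.conj_eq_iff_im, ← hdd, coeff_C_mul, map_mul, map_inv₀, he, hc]
  · simp

lemma approxMask_support (α : ℤ →₀ ℝ) (ξ : ℝ) :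
    (Function.support fun j : ℤ =>
      if Even j then (approxCoeff (evenPart α) ξ (j / 2)).re else α j).Finite := by
  set N : ℤ := (shiftExp (evenPart α) : ℤ)
  set P := approxPoly ((symbolPoly (evenPart α)).map (algebraMap ℝ ℂ)) ξ with hP
  refine ((α.support.finite_toSet).union (Set.finite_Icc (-2 * N)
    (2 * (P.natDegree : ℤ) + 1))).subset ?_
  intro j hj
  rw [Function.mem_support] at hj
  by_cases he : Even j
  · right
    rw [if_pos he] at hj
    have h0 : approxCoeff (evenPart α) ξ (j / 2) ≠ 0 := fun h => hj (by simp [h])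
    unfold approxCoeff at h0
    split_ifs at h0 with h
    · have := Polynomial.le_natDegree_of_ne_zero h0
      rw [← hP] at this
      constructor <;> omega
    · exact absurd rfl h0
  · left
    rw [if_neg he] at hj
    simpa using hj

/-- The approximating mask of `α` with parameter `ξ`: its even elements are the coefficients of the
reversible approximation of the symbol of `α ↓ 2`, its odd elements are those of `α`. -/
def approxMask (α : ℤ →₀ ℝ) (ξ : ℝ) : ℤ →₀ ℝ :=
  Finsupp.ofSupportFinite
    (fun j : ℤ => if Even j then (approxCoeff (evenPart α) ξ (j / 2)).re else α j)
    (approxMask_support α ξ)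

/-- The subdivision (refinement) operator with mask `α`. -/
def subdivide (α : ℤ →₀ ℝ) (c : ℤ → ℝ) : ℤ → ℝ :=
  fun j => ∑ᶠ k : ℤ, α (j - 2 * k) * c k

/-- `f` is the limit function of the scheme with mask `α` from the initial data `c`: it is continuous
and the refined values on the grids `2 ^ (-n) ℤ` converge to it, uniformly on every bounded closed
interval. -/
def IsLimitFunction (α : ℤ →₀ ℝ) (c : ℤ → ℝ) (f : ℝ → ℝ) : Prop :=
  Continuous f ∧ ∀ a b ε : ℝ, 0 < ε → ∃ n₀ : ℕ, ∀ n ≥ n₀, ∀ j : ℤ,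
    (j : ℝ) / 2 ^ n ∈ Set.Icc a b → |(subdivide α)^[n] c j - f ((j : ℝ) / 2 ^ n)| < ε

/-- (Uniform) convergence of a subdivision scheme: every initial sequence has a continuous limit
function, and some initial sequence has a limit function that is not identically zero. -/
def IsConvergent (α : ℤ →₀ ℝ) : Prop :=
  (∀ c : ℤ → ℝ, ∃ f : ℝ → ℝ, IsLimitFunction α c f) ∧
    ∃ (c : ℤ → ℝ) (f : ℝ → ℝ), IsLimitFunction α c f ∧ f ≠ 0

end Subdivision

end

open Polynomial

namespace Subdivision

open Filter Topology

/-! Convergence is an open condition among masks of uniformly bounded support that reproduce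
constants, and the approximating mask is a small perturbation of this kind. A nonzero limit function
forces the mask to reproduce constants (`IsLimitFunction.subdivide_one`), and the continuous,
compactly supported limit of the unit impulse forces the differences of the impulse response to tend
to zero uniformly (`IsLimitFunction.abs_diff_impulse_le`). Conversely, for a mask that reproduces
constants, differences below an explicit threshold at a single level `L` make `L` steps halve the
differences of any data, which gives geometric decay and hence convergence
(`isConvergent_of_contractive`). At a fixed level the threshold amounts to finitely many strict
inequalities between polynomials in the mask entries, so it survives small perturbations
(`IsConvergent.eventually`). For the approximating mask, the coefficients of a product of linear
factors depend continuously on its zeros. The normalization at `1` recovers the original symbol at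
`ξ = 0` and keeps the even sum rule; the odd entries do not change. -/

/-! ### Iterated subdivision: finite sums, locality, shifts -/

/-- The subdivision operator of a mask supported in `[-N, N]` as an explicit finite sum. -/
lemma subdivide_apply {β : ℤ →₀ ℝ} {N : ℕ} (hN : ∀ i, β i ≠ 0 → |i| ≤ N) (c : ℤ → ℝ) (j : ℤ) :
    subdivide β c j =
      ∑ i ∈ Finset.Icc (-N : ℤ) N, if 2 ∣ j - i then β i * c ((j - i) / 2) else 0 := by
  unfold subdivide
  rw [finsum_eq_sum_of_support_subset
    (s := ((Finset.Icc (-N : ℤ) N).filter (fun i => 2 ∣ j - i)).image fun i => (j - i) / 2),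
    Finset.sum_image, Finset.sum_filter]
  · refine Finset.sum_congr rfl fun i _ => ?_
    split_ifs with h
    · rw [show j - 2 * ((j - i) / 2) = i by omega]
    · rfl
  · intro a ha b hb hab
    simp only [Finset.coe_filter, Set.mem_ofPred_eq] at ha hb hab
    omega
  · intro k hk
    have h1 : β (j - 2 * k) ≠ 0 := fun h => hk (by simp [h])
    have h2 := abs_le.1 (hN _ h1)
    simp only [Finset.coe_image, Finset.coe_filter, Finset.mem_Icc, Set.mem_image,
      Set.mem_ofPred_eq]
    exact ⟨j - 2 * k, ⟨h2, by omega⟩, by omega⟩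

lemma exists_support_bound (β : ℤ →₀ ℝ) : ∃ N : ℕ, ∀ i, β i ≠ 0 → |i| ≤ N := by
  refine ⟨β.support.sup Int.natAbs, fun i hi => ?_⟩
  have := Finset.le_sup (f := Int.natAbs) (Finsupp.mem_support_iff.2 hi)
  rw [Int.abs_eq_natAbs]
  exact_mod_cast this

/-- The subdivision operator as a linear map. -/
noncomputable def subdivideLin (β : ℤ →₀ ℝ) : (ℤ → ℝ) →ₗ[ℝ] (ℤ → ℝ) where
  toFun := subdivide β
  map_add' c d := by
    obtain ⟨N, hN⟩ := exists_support_bound β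
    ext j
    simp only [Pi.add_apply, subdivide_apply hN, ← Finset.sum_add_distrib]
    refine Finset.sum_congr rfl fun i _ => ?_
    split_ifs <;> ring
  map_smul' t c := by
    obtain ⟨N, hN⟩ := exists_support_bound β
    ext j
    simp only [Pi.smul_apply, subdivide_apply hN, RingHom.id_apply, smul_eq_mul, Finset.mul_sum]
    refine Finset.sum_congr rfl fun i _ => ?_
    split_ifs <;> ring

lemma subdivideLin_pow_apply (β : ℤ →₀ ℝ) (n : ℕ) (c : ℤ → ℝ) :
    (subdivideLin β ^ n) c = (subdivide β)^[n] c := by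
  rw [Module.End.pow_apply]; rfl

/-- Each step doubles indices and spreads data by `N`, so `n` steps spread by `(1 + 2 + ⋯ + 2 ^ (n -
1)) N = (2 ^ n - 1) N`. -/
lemma iterate_subdivide_eq_zero {β : ℤ →₀ ℝ} {N : ℕ} (hN : ∀ i, β i ≠ 0 → |i| ≤ N) (c : ℤ → ℝ)
    (n : ℕ) (j : ℤ) (h : ∀ k, |j - 2 ^ n * k| ≤ (2 ^ n - 1) * N → c k = 0) :
    (subdivide β)^[n] c j = 0 := by
  induction n generalizing j with
  | zero => exact h j (by simp)
  | succ n ih =>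
    rw [Function.iterate_succ_apply', subdivide_apply hN]
    refine Finset.sum_eq_zero fun i hi => ?_
    rw [Finset.mem_Icc] at hi
    split_ifs with hd
    · rw [ih, mul_zero]
      intro k hk
      refine h k ?_
      obtain ⟨m, hm⟩ := hd
      rw [hm, Int.mul_ediv_cancel_left _ two_ne_zero] at hk
      rw [abs_le] at hk ⊢
      have : j - 2 ^ (n + 1) * k = i + 2 * (m - 2 ^ n * k) := by
        rw [pow_succ]; linear_combination hm
      rw [this, pow_succ]
      constructor <;> nlinarith [hi.1, hi.2, hk.1, hk.2]
    · rfl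

lemma iterate_subdivide_shift (β : ℤ →₀ ℝ) (c : ℤ → ℝ) (n : ℕ) (j k : ℤ) :
    (subdivide β)^[n] (fun m => c (m - k)) j = (subdivide β)^[n] c (j - 2 ^ n * k) := by
  obtain ⟨N, hN⟩ := exists_support_bound β
  induction n generalizing j with
  | zero => simp
  | succ n ih =>
    rw [Function.iterate_succ_apply', Function.iterate_succ_apply', subdivide_apply hN,
      subdivide_apply hN]
    refine Finset.sum_congr rfl fun i _ => ?_
    have e : j - 2 ^ (n + 1) * k - i = j - i - 2 * (2 ^ n * k) := by ring
    rw [e]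
    generalize hq : (2 ^ n * k : ℤ) = q at *
    rw [ih, show (j - i - 2 * q) / 2 = (j - i) / 2 - q by omega]
    exact if_congr (by omega) rfl rfl

/-- The values after `n` refinement steps from the unit impulse at `0`. -/
noncomputable def impulse (β : ℤ →₀ ℝ) (n : ℕ) : ℤ → ℝ := (subdivide β)^[n] (Pi.single 0 1)

lemma impulse_eq_zero {β : ℤ →₀ ℝ} {N : ℕ} (hN : ∀ i, β i ≠ 0 → |i| ≤ N) {n : ℕ} {j : ℤ}
    (h : (2 ^ n - 1) * N < |j|) : impulse β n j = 0 := by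
  refine iterate_subdivide_eq_zero hN _ n j fun k hk => ?_
  rw [Pi.single_apply, if_neg]
  rintro rfl
  rw [mul_zero, sub_zero] at hk
  exact absurd hk (not_le.2 h)

/-- By linearity and locality: subtracting the combination of shifted impulses leaves data that
vanish wherever they could influence `j`. Leaving `F` free lets one window serve several `j`. -/
lemma iterate_subdivide_eq_sum {β : ℤ →₀ ℝ} {N : ℕ} (hN : ∀ i, β i ≠ 0 → |i| ≤ N) (c : ℤ → ℝ)
    (n : ℕ) (j : ℤ) (F : Finset ℤ) (hF : ∀ k, |j - 2 ^ n * k| ≤ (2 ^ n - 1) * N → k ∈ F) :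
    (subdivide β)^[n] c j = ∑ k ∈ F, c k * impulse β n (j - 2 ^ n * k) := by
  have h0 := iterate_subdivide_eq_zero hN
    (c - ∑ k ∈ F, c k • (fun m => (Pi.single 0 1 : ℤ → ℝ) (m - k))) n j (by
      intro k hk
      have hkF := hF k hk
      simp only [Pi.sub_apply, Finset.sum_apply, Pi.smul_apply, smul_eq_mul, Pi.single_apply,
        sub_eq_zero]
      simp [hkF])
  rw [← subdivideLin_pow_apply, map_sub, map_sum] at h0
  simp only [map_smul, subdivideLin_pow_apply, Pi.sub_apply, Finset.sum_apply, Pi.smul_apply,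
    smul_eq_mul, sub_eq_zero] at h0
  rw [h0]
  refine Finset.sum_congr rfl fun k _ => ?_
  rw [iterate_subdivide_shift]
  rfl

/-! ### Reproduction of constants and difference estimates -/

lemma iterate_subdivide_const {β : ℤ →₀ ℝ} (h1 : subdivide β 1 = 1) (n : ℕ) :
    (subdivide β)^[n] 1 = 1 :=
  Function.iterate_fixed h1 n

lemma iterate_subdivide_sub_const {β : ℤ →₀ ℝ} (h1 : subdivide β 1 = 1) (n : ℕ) (c : ℤ → ℝ)
    (t : ℝ) (j : ℤ) :
    (subdivide β)^[n] (fun k => c k - t) j = (subdivide β)^[n] c j - t := by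
  have : (fun k => c k - t) = c - t • (1 : ℤ → ℝ) := by ext; simp
  rw [this, ← subdivideLin_pow_apply, map_sub, map_smul, subdivideLin_pow_apply,
    subdivideLin_pow_apply, iterate_subdivide_const h1]
  simp

lemma abs_sub_le_of_abs_diff_le {c : ℤ → ℝ} {M : ℝ} (hM : ∀ k, |c (k + 1) - c k| ≤ M) (a b : ℤ) :
    |c a - c b| ≤ |(a - b : ℤ)| * M := by
  have key : ∀ (n : ℕ) (b : ℤ), |c (b + n) - c b| ≤ n * M := by
    intro n b
    induction n with
    | zero => simp
    | succ n ih =>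
      have := abs_sub_le (c (b + (n + 1 : ℕ))) (c (b + n)) (c b)
      have h2 := hM (b + n)
      rw [add_assoc] at h2
      push_cast at *
      linarith
  rcases le_total b a with h | h
  · obtain ⟨n, hn⟩ := Int.eq_ofNat_of_zero_le (sub_nonneg.2 h)
    have := key n b
    rw [hn, show a = b + n by omega]
    simpa using this
  · obtain ⟨n, hn⟩ := Int.eq_ofNat_of_zero_le (sub_nonneg.2 h)
    have := key n a
    rw [abs_sub_comm, abs_sub_comm a b, hn, show b = a + n by omega]
    simpa using this

/-- Differences after `n` steps are controlled by the differences of the impulse response. -/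
lemma abs_diff_iterate_le {β : ℤ →₀ ℝ} {N : ℕ} (hN : ∀ i, β i ≠ 0 → |i| ≤ N)
    (h1 : subdivide β 1 = 1) {n : ℕ} {D : ℝ}
    (hD : ∀ j, |impulse β n (j + 1) - impulse β n j| ≤ D) {c : ℤ → ℝ} {M : ℝ}
    (hM : ∀ k, |c (k + 1) - c k| ≤ M) (j : ℤ) :
    |(subdivide β)^[n] c (j + 1) - (subdivide β)^[n] c j| ≤ ((2 * N + 3) * (N + 1) * D) * M := by
  have hM0 : 0 ≤ M := (abs_nonneg _).trans (hM 0)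
  have hD0 : 0 ≤ D := (abs_nonneg _).trans (hD 0)
  set k₀ : ℤ := j / 2 ^ n with hk₀
  have hp : (0 : ℤ) < 2 ^ n := by positivity
  have hr0 := Int.emod_nonneg j hp.ne'
  have hr1 := Int.emod_lt_of_pos j hp
  have hj := Int.mul_ediv_add_emod j (2 ^ n)
  rw [← hk₀] at hj
  set F := Finset.Icc (k₀ - (N + 1)) (k₀ + (N + 1)) with hF
  have hwin : ∀ s : ℤ, 0 ≤ s → s ≤ 2 ^ n → ∀ k : ℤ,
      |2 ^ n * k₀ + s - 2 ^ n * k| ≤ (2 ^ n - 1) * N → k ∈ F := by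
    intro s hs0 hs1 k hk
    rw [abs_le] at hk
    have hNn : (0 : ℤ) ≤ N := by positivity
    rw [hF, Finset.mem_Icc]
    constructor
    · have : 2 ^ n * (k₀ - k) ≤ 2 ^ n * (N + 1 : ℤ) := by nlinarith
      have := le_of_mul_le_mul_left this hp
      omega
    · have : 2 ^ n * (k - k₀) ≤ 2 ^ n * (N + 1 : ℤ) := by nlinarith
      have := le_of_mul_le_mul_left this hp
      omega
  -- Constants are reproduced, so `c k₀` may be subtracted from the data; only increments of `c`
  -- over at most `N + 1` indices remain.
  have e1 := iterate_subdivide_sub_const h1 n c (c k₀) (j + 1)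
  have e2 := iterate_subdivide_sub_const h1 n c (c k₀) j
  rw [iterate_subdivide_eq_sum hN _ n _ F (fun k hk => hwin (j % 2 ^ n + 1) (by omega) (by omega) k
    (by rw [← add_assoc, hj]; exact hk))] at e1
  rw [iterate_subdivide_eq_sum hN _ n _ F (fun k hk => hwin (j % 2 ^ n) (by omega) (by omega) k
    (by rw [hj]; exact hk))] at e2
  have e3 : (subdivide β)^[n] c (j + 1) - (subdivide β)^[n] c j = ∑ k ∈ F, (c k - c k₀) *
      (impulse β n (j - 2 ^ n * k + 1) - impulse β n (j - 2 ^ n * k)) := by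
    rw [← sub_sub_sub_cancel_right _ _ (c k₀), ← e1, ← e2, ← Finset.sum_sub_distrib]
    refine Finset.sum_congr rfl fun k _ => ?_
    rw [show j + 1 - 2 ^ n * k = j - 2 ^ n * k + 1 by ring]
    ring
  rw [e3]
  -- The window has `2 * N + 3` indices.
  calc _ ≤ ∑ k ∈ F, ((N + 1) * M) * D := by
        refine (Finset.abs_sum_le_sum_abs _ _).trans (Finset.sum_le_sum fun k hk => ?_)
        rw [abs_mul]
        refine mul_le_mul ((abs_sub_le_of_abs_diff_le hM k k₀).trans ?_) (hD _) (abs_nonneg _)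
          (by positivity)
        refine mul_le_mul_of_nonneg_right ?_ hM0
        rw [hF, Finset.mem_Icc] at hk
        have : |k - k₀| ≤ N + 1 := by rw [abs_le]; omega
        exact_mod_cast this
    _ = _ := by
        rw [Finset.sum_const, hF, Int.card_Icc,
          show (k₀ + (N + 1 : ℤ) + 1 - (k₀ - (N + 1))).toNat = 2 * N + 3 by omega]
        push_cast [nsmul_eq_mul]
        ring

/-- Compares a refined value with its parent at index `j / 2`; this makes successive levels Cauchy
once differences decay geometrically. -/
lemma abs_subdivide_sub_le {β : ℤ →₀ ℝ} {N : ℕ} (hN : ∀ i, β i ≠ 0 → |i| ≤ N)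
    (h1 : subdivide β 1 = 1) {c : ℤ → ℝ} {M : ℝ} (hM : ∀ k, |c (k + 1) - c k| ≤ M) (j : ℤ) :
    |subdivide β c j - c (j / 2)| ≤ (∑ i ∈ Finset.Icc (-N : ℤ) N, |β i|) * (N + 1) * M := by
  have hM0 : 0 ≤ M := (abs_nonneg _).trans (hM 0)
  have e := iterate_subdivide_sub_const h1 1 c (c (j / 2)) j
  simp only [Function.iterate_one] at e
  rw [← e, subdivide_apply hN, Finset.sum_mul, Finset.sum_mul]
  refine (Finset.abs_sum_le_sum_abs _ _).trans (Finset.sum_le_sum fun i hi => ?_)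
  rw [Finset.mem_Icc] at hi
  split_ifs
  · rw [abs_mul, mul_assoc]
    refine mul_le_mul_of_nonneg_left ((abs_sub_le_of_abs_diff_le hM _ _).trans ?_) (abs_nonneg _)
    refine mul_le_mul_of_nonneg_right ?_ hM0
    have : |(j - i) / 2 - j / 2| ≤ N + 1 := by rw [abs_le]; omega
    exact_mod_cast this
  · rw [abs_zero]; positivity

/-! ### Necessary conditions for convergence -/

lemma IsLimitFunction.tendsto {β : ℤ →₀ ℝ} {c : ℤ → ℝ} {f : ℝ → ℝ} (hf : IsLimitFunction β c f)
    {j : ℕ → ℤ} {x : ℝ} (hj : Tendsto (fun n => (j n : ℝ) / 2 ^ n) atTop (𝓝 x)) :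
    Tendsto (fun n => (subdivide β)^[n] c (j n)) atTop (𝓝 (f x)) := by
  have h1 : Tendsto (fun n => f ((j n : ℝ) / 2 ^ n)) atTop (𝓝 (f x)) :=
    (hf.1.tendsto x).comp hj
  have h2 : Tendsto (fun n => (subdivide β)^[n] c (j n) - f ((j n : ℝ) / 2 ^ n)) atTop (𝓝 0) := by
    rw [Metric.tendsto_atTop]
    intro ε hε
    obtain ⟨n₀, hn₀⟩ := hf.2 (x - 1) (x + 1) ε hε
    obtain ⟨n₁, hn₁⟩ := eventually_atTop.1 (hj.eventually (Icc_mem_nhds (sub_one_lt x) (lt_add_one x)))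
    refine ⟨max n₀ n₁, fun n hn => ?_⟩
    rw [Real.dist_eq, sub_zero]
    exact hn₀ n (le_of_max_le_left hn) _ (hn₁ n (le_of_max_le_right hn))
  simpa using h2.add h1

lemma tendsto_floor_add_div (x : ℝ) (t : ℤ) :
    Tendsto (fun n : ℕ => ((⌊2 ^ n * x⌋ + t : ℤ) : ℝ) / 2 ^ n) atTop (𝓝 x) := by
  have hg : Tendsto (fun n : ℕ => (|(t : ℝ)| + 1) * (1 / 2 : ℝ) ^ n) atTop (𝓝 0) := by
    simpa using (tendsto_pow_atTop_nhds_zero_of_lt_one (r := (1 / 2 : ℝ)) (by norm_num)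
      (by norm_num)).const_mul (|(t : ℝ)| + 1)
  rw [tendsto_iff_dist_tendsto_zero]
  refine squeeze_zero (fun _ => dist_nonneg) (fun n => ?_) hg
  have hp : (0 : ℝ) < 2 ^ n := by positivity
  rw [Real.dist_eq, one_div, inv_pow, ← div_eq_mul_inv, le_div_iff₀ hp]
  rw [show ∀ y : ℝ, |y| * 2 ^ n = |y * 2 ^ n| from fun y => by rw [abs_mul, abs_of_pos hp],
    sub_mul, div_mul_cancel₀ _ hp.ne']
  push_cast
  have h1 := Int.floor_le (2 ^ n * x)
  have h2 := Int.lt_floor_add_one (2 ^ n * x)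
  rw [abs_le]
  constructor <;> nlinarith [neg_abs_le (t : ℝ), le_abs_self (t : ℝ)]

/-- A scheme with a nonzero limit function reproduces constants. -/
lemma IsLimitFunction.subdivide_one {β : ℤ →₀ ℝ} {c : ℤ → ℝ} {f : ℝ → ℝ}
    (hf : IsLimitFunction β c f) (h0 : f ≠ 0) : subdivide β 1 = 1 := by
  obtain ⟨x, hx⟩ := Function.ne_iff.1 h0
  obtain ⟨N, hN⟩ := exists_support_bound β
  ext j
  -- The same sequence gets two limits: directly `f x`, and by expanding the last refinement step
  -- `subdivide β 1 j * f x`. Its indices keep the parity of `j`, so the same mask entries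
  -- contribute at each level.
  have hl : Tendsto (fun n : ℕ => (subdivide β)^[n + 1] c (j + 2 * ⌊2 ^ n * x⌋)) atTop
      (𝓝 (f x)) := by
    have h2 : Tendsto (fun n : ℕ => ((j + 2 * ⌊(2 : ℝ) ^ (n - 1) * x⌋ : ℤ) : ℝ) / 2 ^ n) atTop
        (𝓝 x) := by
      rw [← tendsto_add_atTop_iff_nat 1]
      have h3 := tendsto_floor_add_div x 0
      have h4 : Tendsto (fun n : ℕ => ((j : ℝ) / 2) * (1 / 2 : ℝ) ^ n) atTop (𝓝 0) := by
        simpa using (tendsto_pow_atTop_nhds_zero_of_lt_one (r := (1 / 2 : ℝ)) (by norm_num)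
          (by norm_num)).const_mul ((j : ℝ) / 2)
      have h5 := h4.add h3
      rw [zero_add] at h5
      refine h5.congr fun n => ?_
      rw [Nat.add_sub_cancel, pow_succ]
      push_cast
      have hp : (2 : ℝ) ^ n ≠ 0 := by positivity
      rw [one_div, inv_pow]
      field_simp
      ring
    have h6 := (tendsto_add_atTop_iff_nat 1).2 (hf.tendsto h2)
    simpa using h6
  have hr : Tendsto (fun n : ℕ => (subdivide β)^[n + 1] c (j + 2 * ⌊2 ^ n * x⌋)) atTop
      (𝓝 (subdivide β 1 j * f x)) := by
    simp only [Function.iterate_succ_apply', subdivide_apply hN, Finset.sum_mul]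
    refine tendsto_finsetSum _ fun i _ => ?_
    by_cases hd : 2 ∣ j - i
    · rw [if_pos hd]
      have := (hf.tendsto (tendsto_floor_add_div x ((j - i) / 2))).const_mul (β i)
      simp only [Pi.one_apply, mul_one]
      refine this.congr fun n => ?_
      rw [if_pos (by omega)]
      rw [show (j + 2 * ⌊2 ^ n * x⌋ - i) / 2 = ⌊2 ^ n * x⌋ + (j - i) / 2 by omega]
    · rw [if_neg hd, zero_mul]
      refine tendsto_const_nhds.congr fun n => ?_
      rw [if_neg (by omega)]
  have := tendsto_nhds_unique hr hl
  exact mul_right_cancel₀ hx (by simpa using this)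

/-- The differences of the impulse response of a scheme converging from the unit impulse tend to
zero uniformly. -/
lemma IsLimitFunction.abs_diff_impulse_le {β : ℤ →₀ ℝ} {f : ℝ → ℝ}
    (hf : IsLimitFunction β (Pi.single 0 1) f) {ε : ℝ} (hε : 0 < ε) :
    ∃ n₀ : ℕ, ∀ n ≥ n₀, ∀ j, |impulse β n (j + 1) - impulse β n j| < ε := by
  obtain ⟨N, hN⟩ := exists_support_bound β
  have huc := (isCompact_Icc (a := -(N + 1 : ℝ)) (b := N + 1)).uniformContinuousOn_of_continuous
    hf.1.continuousOn
  obtain ⟨η, hη, hu⟩ := Metric.uniformContinuousOn_iff.1 huc (ε / 3) (by positivity)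
  obtain ⟨n₀, hn₀⟩ := hf.2 (-(N + 1)) (N + 1) (ε / 3) (by positivity)
  obtain ⟨n₁, hn₁⟩ := exists_pow_lt_of_lt_one hη (by norm_num : (1 / 2 : ℝ) < 1)
  refine ⟨max n₀ n₁, fun n hn j => ?_⟩
  have hp : (0 : ℝ) < 2 ^ n := by positivity
  have hpz : (0 : ℤ) < 2 ^ n := by positivity
  -- Either both values vanish, or both grid points lie in the compact interval where `f` is
  -- uniformly continuous.
  by_cases hj : (2 ^ n - 1) * N < |j| ∧ (2 ^ n - 1) * N < |j + 1|
  · rw [impulse_eq_zero hN hj.1, impulse_eq_zero hN hj.2]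
    simpa using hε
  · have hj' : |j| ≤ 2 ^ n * (N + 1) ∧ |j + 1| ≤ 2 ^ n * (N + 1) := by
      have hNn : (0 : ℤ) ≤ N := by positivity
      have key : (2 ^ n - 1 : ℤ) * N + 1 ≤ 2 ^ n * (N + 1) := by nlinarith
      have t1 := abs_add_le j 1
      have t2 := abs_add_le (j + 1) (-1)
      rw [add_neg_cancel_right] at t2
      simp only [abs_neg, abs_one] at t1 t2
      rw [not_and_or, not_lt, not_lt] at hj
      constructor <;> rcases hj with hj | hj <;> linarith
    have mem : ∀ i : ℤ, |i| ≤ 2 ^ n * (N + 1) →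
        (i : ℝ) / 2 ^ n ∈ Set.Icc (-(N + 1 : ℝ)) (N + 1) := by
      intro i hi
      have : |(i : ℝ)| ≤ 2 ^ n * (N + 1) := by exact_mod_cast hi
      rw [abs_le] at this
      rw [Set.mem_Icc, le_div_iff₀ hp, div_le_iff₀ hp]
      constructor <;> linarith
    have a1 := hn₀ n (le_of_max_le_left hn) _ (mem _ hj'.1)
    have a2 := hn₀ n (le_of_max_le_left hn) _ (mem _ hj'.2)
    have a3 := hu _ (mem _ hj'.2) _ (mem _ hj'.1) (by
      rw [Real.dist_eq, ← sub_div]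
      push_cast
      rw [add_sub_cancel_left, abs_of_pos (by positivity)]
      refine lt_of_le_of_lt ?_ hn₁
      rw [← one_div_pow]
      exact pow_le_pow_of_le_one (by norm_num) (by norm_num) (le_of_max_le_right hn))
    rw [Real.dist_eq] at a3
    change |impulse β n j - _| < _ at a1
    change |impulse β n (j + 1) - _| < _ at a2
    rw [abs_lt] at *
    constructor <;> linarith

/-! ### Contractivity implies convergence -/

lemma exists_abs_diff_impulse_le (β : ℤ →₀ ℝ) (n : ℕ) :
    ∃ D : ℝ, ∀ j, |impulse β n (j + 1) - impulse β n j| ≤ D := by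
  obtain ⟨N, hN⟩ := exists_support_bound β
  set F := Finset.Icc (-((2 ^ n - 1) * N : ℤ)) ((2 ^ n - 1) * N)
  have key : ∀ j, |impulse β n j| ≤ ∑ i ∈ F, |impulse β n i| := by
    intro j
    by_cases hj : (2 ^ n - 1) * N < |j|
    · rw [impulse_eq_zero hN hj, abs_zero]; positivity
    · exact Finset.single_le_sum (f := fun i => |impulse β n i|) (fun _ _ => abs_nonneg _)
        (Finset.mem_Icc.2 (abs_le.1 (not_lt.1 hj)))
  refine ⟨_, fun j => (abs_sub _ _).trans (add_le_add (key _) (key _))⟩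

/-- By `abs_diff_iterate_le`, `L` further steps halve any difference bound. Hence `ρ ^ L = 1 / 2`,
with `K` large enough for the first `L` levels. -/
lemma exists_geometric_abs_diff_impulse_le {β : ℤ →₀ ℝ} {N : ℕ} (hN : ∀ i, β i ≠ 0 → |i| ≤ N)
    (h1 : subdivide β 1 = 1) {L : ℕ} (hL : 0 < L) {D : ℝ}
    (hD : ∀ j, |impulse β L (j + 1) - impulse β L j| ≤ D)
    (hD2 : (2 * N + 3) * (N + 1) * D ≤ 1 / 2) :
    ∃ K ρ : ℝ, 0 < ρ ∧ ρ < 1 ∧ ∀ n j, |impulse β n (j + 1) - impulse β n j| ≤ K * ρ ^ n := by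
  choose E hE using exists_abs_diff_impulse_le β
  have hE0 : ∀ n, 0 ≤ E n := fun n => (abs_nonneg _).trans (hE n 0)
  obtain ⟨ρ, hρ0, hρL⟩ : ∃ ρ : ℝ, 0 < ρ ∧ ρ ^ L = 1 / 2 :=
    ⟨(1 / 2 : ℝ) ^ (1 / (L : ℝ)), by positivity, by
      rw [← Real.rpow_natCast, ← Real.rpow_mul (by norm_num), one_div_mul_cancel (by positivity),
        Real.rpow_one]⟩
  have hρ1 : ρ < 1 := by
    by_contra h
    have := one_le_pow₀ (not_lt.1 h) (n := L)
    norm_num [hρL] at this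
  refine ⟨∑ i ∈ Finset.range L, E i / ρ ^ i, ρ, hρ0, hρ1, fun n => ?_⟩
  set K := ∑ i ∈ Finset.range L, E i / ρ ^ i
  induction n using Nat.strong_induction_on with
  | _ n ih =>
    intro j
    rcases lt_or_ge n L with h | h
    · refine (hE n j).trans ?_
      rw [← div_le_iff₀ (by positivity)]
      exact Finset.single_le_sum (f := fun i => E i / ρ ^ i)
        (fun i _ => div_nonneg (hE0 i) (by positivity)) (Finset.mem_range.2 h)
    · obtain ⟨m, rfl⟩ := Nat.exists_eq_add_of_le h
      have hm := ih m (by omega)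
      have := abs_diff_iterate_le hN h1 hD hm j
      rw [impulse, Function.iterate_add_apply, pow_add, hρL]
      refine this.trans ?_
      nlinarith [(abs_nonneg _).trans (hm 0)]

/-- The basic limit function of a contractive scheme. -/
lemma exists_basic_limit_function {β : ℤ →₀ ℝ} {N : ℕ} (hN : ∀ i, β i ≠ 0 → |i| ≤ N)
    (h1 : subdivide β 1 = 1) {K ρ : ℝ} (hρ0 : 0 < ρ) (hρ1 : ρ < 1)
    (hK : ∀ n j, |impulse β n (j + 1) - impulse β n j| ≤ K * ρ ^ n) :
    ∃ φ : ℝ → ℝ, Continuous φ ∧ (∀ x : ℝ, (N + 1 : ℝ) < |x| → φ x = 0) ∧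
      ∀ ε : ℝ, 0 < ε → ∃ n₀ : ℕ, ∀ n ≥ n₀, ∀ j : ℤ,
        |impulse β n j - φ ((j : ℝ) / 2 ^ n)| ≤ ε := by
  -- Step functions through the level-`n` values. Since `⌊2 ^ (n + 1) * x⌋ / 2 = ⌊2 ^ n * x⌋`,
  -- successive ones differ by a parent–child difference.
  set g : ℝ → ℕ → ℝ := fun x n => impulse β n ⌊2 ^ n * x⌋ with hg
  set A : ℝ := (∑ i ∈ Finset.Icc (-N : ℤ) N, |β i|) * (N + 1) * K
  have hstep : ∀ x n, dist (g x n) (g x (n + 1)) ≤ A * ρ ^ n := by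
    intro x n
    have hfl : ⌊2 ^ (n + 1) * x⌋ / 2 = ⌊2 ^ n * x⌋ := by
      have := Int.floor_div_natCast ((2 : ℝ) ^ (n + 1) * x) 2
      rw [show (2 : ℝ) ^ (n + 1) * x / (2 : ℕ) = 2 ^ n * x by push_cast; ring] at this
      exact_mod_cast this.symm
    have := abs_subdivide_sub_le hN h1 (hK n) ⌊2 ^ (n + 1) * x⌋
    rw [hfl] at this
    rw [dist_comm, Real.dist_eq, hg]
    simp only [impulse, Function.iterate_succ_apply'] at this ⊢
    linarith
  choose φ hφ using fun x => cauchySeq_tendsto_of_complete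
    (cauchySeq_of_le_geometric ρ A hρ1 (hstep x))
  have herr : ∀ x n, |g x n - φ x| ≤ A * ρ ^ n / (1 - ρ) := fun x n =>
    dist_le_of_le_geometric_of_tendsto ρ A hρ1 (hstep x) (hφ x) n
  have hsmall : ∀ B : ℝ, Tendsto (fun n : ℕ => B * ρ ^ n) atTop (𝓝 0) := fun B => by
    simpa using (tendsto_pow_atTop_nhds_zero_of_lt_one hρ0.le hρ1).const_mul B
  refine ⟨φ, ?_, ?_, ?_⟩
  -- The `g · n` are not continuous, but points closer than `2 ^ (-n)` have floors at most one
  -- apart, so `g · n` varies by at most `K * ρ ^ n` there.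
  · rw [Metric.continuous_iff]
    intro x ε hε
    obtain ⟨n, hn⟩ := ((hsmall (2 * A / (1 - ρ) + K)).eventually (gt_mem_nhds hε)).exists
    have hp : (0 : ℝ) < 2 ^ n := by positivity
    refine ⟨1 / 2 ^ n, by positivity, fun y hy => ?_⟩
    rw [Real.dist_eq, lt_div_iff₀ hp, abs_sub_comm] at hy
    have hK0 : 0 ≤ K * ρ ^ n := (abs_nonneg _).trans (hK n 0)
    have hfl : |g y n - g x n| ≤ K * ρ ^ n := by
      have hd : |⌊2 ^ n * y⌋ - ⌊2 ^ n * x⌋| ≤ 1 := by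
        have a1 := Int.floor_le (2 ^ n * x)
        have a2 := Int.lt_floor_add_one (2 ^ n * x)
        have a3 := Int.floor_le (2 ^ n * y)
        have a4 := Int.lt_floor_add_one (2 ^ n * y)
        have hy1 := mul_le_mul_of_nonneg_right (le_abs_self (x - y)) hp.le
        have hy2 := mul_le_mul_of_nonneg_right (neg_abs_le (x - y)) hp.le
        have b1 : ⌊2 ^ n * y⌋ < ⌊2 ^ n * x⌋ + 2 := by
          exact_mod_cast (by linarith : (⌊2 ^ n * y⌋ : ℝ) < ⌊2 ^ n * x⌋ + 2)
        have b2 : ⌊2 ^ n * x⌋ < ⌊2 ^ n * y⌋ + 2 := by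
          exact_mod_cast (by linarith : (⌊2 ^ n * x⌋ : ℝ) < ⌊2 ^ n * y⌋ + 2)
        rw [abs_le]; omega
      refine (abs_sub_le_of_abs_diff_le (hK n) _ _).trans ?_
      have : ((|⌊2 ^ n * y⌋ - ⌊2 ^ n * x⌋| : ℤ) : ℝ) ≤ 1 := by exact_mod_cast hd
      simpa using mul_le_mul_of_nonneg_right this hK0
    have e1 := herr x n
    have e2 := herr y n
    have e3 : (2 * A / (1 - ρ) + K) * ρ ^ n = 2 * (A * ρ ^ n / (1 - ρ)) + K * ρ ^ n := by ring
    rw [Real.dist_eq]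
    rw [e3] at hn
    rw [abs_le] at hfl e1 e2
    rw [abs_lt]
    constructor <;> linarith
  · intro x hx
    refine tendsto_nhds_unique (hφ x) (tendsto_const_nhds.congr fun n => ?_)
    refine (impulse_eq_zero hN ?_).symm
    have hp : (1 : ℝ) ≤ 2 ^ n := one_le_pow₀ one_le_two
    have a1 := Int.floor_le (2 ^ n * x)
    have a2 := Int.lt_floor_add_one (2 ^ n * x)
    have hNn : (0 : ℝ) ≤ N := by positivity
    have : ((2 ^ n - 1) * N : ℝ) < |(⌊2 ^ n * x⌋ : ℝ)| := by
      rw [lt_abs] at hx ⊢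
      rcases hx with hx | hx
      · left; nlinarith
      · right; nlinarith
    exact_mod_cast this
  · intro ε hε
    obtain ⟨n₀, hn₀⟩ := eventually_atTop.1
      ((hsmall (A / (1 - ρ))).eventually (gt_mem_nhds hε))
    refine ⟨n₀, fun n hn j => ?_⟩
    have hp : (2 : ℝ) ^ n ≠ 0 := by positivity
    have e := herr ((j : ℝ) / 2 ^ n) n
    simp only [hg, mul_div_cancel₀ _ hp, Int.floor_intCast] at e
    refine e.trans (le_of_eq_of_le ?_ (hn₀ n hn).le)
    ring

/-- Contractivity of the differences after some number of steps implies convergence. -/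
theorem isConvergent_of_contractive {β : ℤ →₀ ℝ} {N : ℕ} (hN : ∀ i, β i ≠ 0 → |i| ≤ N)
    (h1 : subdivide β 1 = 1) {L : ℕ} (hL : 0 < L) {D : ℝ}
    (hD : ∀ j, |impulse β L (j + 1) - impulse β L j| ≤ D)
    (hD2 : (2 * N + 3) * (N + 1) * D ≤ 1 / 2) : IsConvergent β := by
  obtain ⟨K, ρ, hρ0, hρ1, hK⟩ := exists_geometric_abs_diff_impulse_le hN h1 hL hD hD2
  obtain ⟨φ, hφc, hφ0, hφ⟩ := exists_basic_limit_function hN h1 hρ0 hρ1 hK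
  -- The limit for `c` is the superposition of translates of `φ`; the constant data `1` give the
  -- nonzero limit `1`.
  refine ⟨fun c => ⟨fun x => ∑ᶠ k : ℤ, c k * φ (x - k), ?_, ?_⟩, 1, 1, ⟨continuous_one, ?_⟩,
    one_ne_zero⟩
  · refine continuous_finsum (fun k => by fun_prop) fun x => ⟨Metric.ball x 1,
      Metric.ball_mem_nhds x one_pos, (Set.finite_Icc (⌊x⌋ - (N + 3)) (⌊x⌋ + (N + 3))).subset ?_⟩
    rintro k ⟨y, hy, hyx⟩
    have hk : |y - k| ≤ N + 1 := by
      by_contra h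
      exact hy (by simp [hφ0 _ (not_le.1 h)])
    rw [Metric.mem_ball, Real.dist_eq, abs_lt] at hyx
    rw [abs_le] at hk
    have a1 := Int.floor_le x
    have a2 := Int.lt_floor_add_one x
    constructor
    · exact_mod_cast (by linarith : (⌊x⌋ - (N + 3) : ℝ) ≤ k)
    · exact_mod_cast (by linarith : (k : ℝ) ≤ ⌊x⌋ + (N + 3))
  · intro a b ε hε
    -- One finite window carries both the refined values and the limit function over `[a, b]`.
    set F := Finset.Icc (⌊a⌋ - (N + 1)) (⌈b⌉ + (N + 1)) with hF
    have hmem : ∀ x ∈ Set.Icc a b, ∀ k : ℤ, |x - k| ≤ N + 1 → k ∈ F := by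
      intro x hx k hk
      rw [abs_le] at hk
      have a1 := Int.floor_le a
      have a2 := Int.le_ceil b
      rw [hF, Finset.mem_Icc]
      constructor
      · exact_mod_cast (by linarith [hx.1] : (⌊a⌋ - (N + 1) : ℝ) ≤ k)
      · exact_mod_cast (by linarith [hx.2] : (k : ℝ) ≤ ⌈b⌉ + (N + 1))
    set T := ∑ k ∈ F, |c k|
    have hT : 0 ≤ T := Finset.sum_nonneg fun _ _ => abs_nonneg _
    obtain ⟨n₀, hn₀⟩ := hφ (ε / (T + 1)) (by positivity)
    refine ⟨n₀, fun n hn j hj => ?_⟩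
    have hp : (0 : ℝ) < 2 ^ n := by positivity
    beta_reduce
    rw [iterate_subdivide_eq_sum hN c n j F, finsum_eq_sum_of_support_subset (s := F),
      ← Finset.sum_sub_distrib]
    · calc _ ≤ ∑ k ∈ F, |c k| * (ε / (T + 1)) := by
            refine (Finset.abs_sum_le_sum_abs _ _).trans (Finset.sum_le_sum fun k _ => ?_)
            rw [← mul_sub, abs_mul]
            refine mul_le_mul_of_nonneg_left ?_ (abs_nonneg _)
            have := hn₀ n hn (j - 2 ^ n * k)
            push_cast at this
            rwa [sub_div, mul_div_cancel_left₀ _ hp.ne'] at this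
        _ < ε := by
            rw [← Finset.sum_mul, mul_div_assoc', div_lt_iff₀ (by positivity)]
            nlinarith
    · intro k hk
      refine hmem _ hj k ?_
      by_contra h
      exact hk (by simp [hφ0 _ (not_le.1 h)])
    · intro k hk
      refine hmem _ hj k ?_
      have h2 : |(j : ℝ) - 2 ^ n * k| ≤ (2 ^ n - 1) * N := by exact_mod_cast hk
      have h3 : (j : ℝ) / 2 ^ n - k = (j - 2 ^ n * k) / 2 ^ n := by field_simp
      rw [h3, abs_div, abs_of_pos hp, div_le_iff₀ hp]
      have hNn : (0 : ℝ) ≤ N := by positivity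
      nlinarith
  · intro a b ε hε
    exact ⟨0, fun n _ j _ => by simpa [iterate_subdivide_const h1] using hε⟩

/-! ### Stability under perturbation of the mask -/

/-- At fixed `n` and `j` the value is a polynomial in the mask entries; the common bound `N` keeps
the index set of the sum independent of `t`. -/
lemma tendsto_iterate_subdivide {ι : Type*} {l : Filter ι} {β : ι → ℤ →₀ ℝ} {α : ℤ →₀ ℝ} {N : ℕ}
    (hβ : ∀ t, ∀ i, β t i ≠ 0 → |i| ≤ N) (hα : ∀ i, α i ≠ 0 → |i| ≤ N)
    (h : ∀ i, Tendsto (fun t => β t i) l (𝓝 (α i))) (c : ℤ → ℝ) (n : ℕ) (j : ℤ) :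
    Tendsto (fun t => (subdivide (β t))^[n] c j) l (𝓝 ((subdivide α)^[n] c j)) := by
  induction n generalizing j with
  | zero => exact tendsto_const_nhds
  | succ n ih =>
    simp only [Function.iterate_succ_apply']
    simp_rw [fun t => subdivide_apply (hβ t)]
    rw [subdivide_apply hα]
    refine tendsto_finsetSum _ fun i _ => ?_
    split_ifs
    · exact (h i).mul (ih _)
    · exact tendsto_const_nhds

/-- Convergence of subdivision schemes is stable under small perturbations of the mask that keep
the reproduction of constants. -/
theorem IsConvergent.eventually {ι : Type*} {l : Filter ι} {β : ι → ℤ →₀ ℝ} {α : ℤ →₀ ℝ} {N : ℕ}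
    (hconv : IsConvergent α)
    (hβ : ∀ t, ∀ i, β t i ≠ 0 → |i| ≤ N) (hα : ∀ i, α i ≠ 0 → |i| ≤ N)
    (h : ∀ i, Tendsto (fun t => β t i) l (𝓝 (α i)))
    (h1 : ∀ᶠ t in l, subdivide (β t) 1 = 1) : ∀ᶠ t in l, IsConvergent (β t) := by
  obtain ⟨f, hf⟩ := hconv.1 (Pi.single 0 1)
  -- Chosen so that the contraction factor is exactly `1 / 2`.
  set D : ℝ := 1 / (2 * ((2 * N + 3) * (N + 1))) with hDdef
  have hD : 0 < D := by positivity
  obtain ⟨n₀, hn₀⟩ := hf.abs_diff_impulse_le hD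
  have hL := hn₀ (n₀ + 1) (by omega)
  set L := n₀ + 1
  -- Outside `F` both `j` and `j + 1` miss the support of the impulse response, for every `t`; the
  -- `+ 1` accounts for `j + 1`.
  set F := Finset.Icc (-((2 ^ L - 1) * N + 1) : ℤ) ((2 ^ L - 1) * N + 1) with hF
  have hev : ∀ᶠ t in l, ∀ j ∈ F, |impulse (β t) L (j + 1) - impulse (β t) L j| < D := by
    rw [eventually_all_finset]
    intro j _
    have ht := ((tendsto_iterate_subdivide hβ hα h (Pi.single 0 1) L (j + 1)).sub
      (tendsto_iterate_subdivide hβ hα h (Pi.single 0 1) L j)).abs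
    exact ht.eventually (gt_mem_nhds (hL j))
  filter_upwards [h1, hev] with t ht1 htF
  refine isConvergent_of_contractive (hβ t) ht1 (L := L) (Nat.succ_pos n₀) (D := D) (fun j => ?_) ?_
  · by_cases hj : j ∈ F
    · exact (htF j hj).le
    · have hj' : (2 ^ L - 1 : ℤ) * N + 1 < |j| := by
        rw [hF, Finset.mem_Icc, ← abs_le, not_le] at hj
        exact hj
      have t2 := abs_add_le (j + 1) (-1)
      rw [add_neg_cancel_right] at t2
      simp only [abs_neg, abs_one] at t2
      rw [impulse_eq_zero (hβ t) (by linarith), impulse_eq_zero (hβ t) (by linarith)]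
      simpa using hD.le
  · rw [hDdef]
    apply le_of_eq
    field_simp

/-! ### Dependence of the approximating mask on `ξ` -/

lemma displaced_zero (p : ℂ[X]) : C p.leadingCoeff * displaced p 0 = p := by
  have h : displaced p 0 = (p.roots.map fun r => X - C r).prod := by
    unfold displaced
    simp
  rw [h]
  exact (IsAlgClosed.splits p).eq_prod_roots.symm

lemma approxPoly_zero {p : ℂ[X]} (hp : p.eval 1 = 1) : approxPoly p 0 = p := by
  have h := displaced_zero p
  have he := congrArg (eval 1) h
  rw [eval_mul, eval_C, hp] at he
  rw [approxPoly, ← eq_inv_of_mul_eq_one_left he, h]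

lemma continuous_coeff_displaced (p : ℂ[X]) (n : ℕ) :
    Continuous fun ξ : ℝ => (displaced p ξ).coeff n := by
  unfold displaced
  induction p.roots using Multiset.induction_on generalizing n with
  | empty => simpa using continuous_const
  | cons r s ih =>
    simp only [Multiset.map_cons, Multiset.prod_cons, coeff_mul]
    refine continuous_finsetSum _ fun x _ => Continuous.mul ?_ (ih _)
    simp only [coeff_sub, coeff_C]
    refine continuous_const.sub ?_
    split_ifs <;> fun_prop

lemma eval_displaced (p : ℂ[X]) (ξ : ℝ) (z : ℂ) : (displaced p ξ).eval z =
    (p.roots.map fun r : ℂ => z - if ‖r‖ = 1 then (1 + (ξ : ℂ)) * r else r).prod := by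
  simp [displaced, eval_multiset_prod, Multiset.map_map]

lemma continuous_eval_displaced (p : ℂ[X]) (z : ℂ) :
    Continuous fun ξ : ℝ => (displaced p ξ).eval z := by
  simp only [eval_displaced]
  refine continuous_multiset_prod _ fun r _ => ?_
  split_ifs <;> fun_prop

/-- A displaced zero has modulus `1 + ξ`, so it can equal `1` only if `ξ = 0`, where it is an
original zero. Hence the normalizing constant is finite. -/
lemma eval_one_displaced_ne_zero {p : ℂ[X]} (hp : p.eval 1 ≠ 0) {ξ : ℝ} (hξ : 0 ≤ ξ) :
    (displaced p ξ).eval 1 ≠ 0 := by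
  rw [eval_displaced]
  refine Multiset.prod_ne_zero fun h0 => ?_
  obtain ⟨r, hr, h⟩ := Multiset.mem_map.1 h0
  have hr1 : r ≠ 1 := by
    rintro rfl
    exact hp (isRoot_of_mem_roots hr)
  rw [sub_eq_zero] at h
  split_ifs at h with hn
  · have := congrArg norm h
    rw [norm_mul, hn, norm_one, mul_one, ← Complex.ofReal_one, ← Complex.ofReal_add,
      Complex.norm_of_nonneg (by positivity)] at this
    obtain rfl : ξ = 0 := by linarith
    exact hr1 (by simpa using h.symm)
  · exact hr1 h.symm

lemma eval_one_approxPoly {p : ℂ[X]} (hp : p.eval 1 ≠ 0) {ξ : ℝ} (hξ : 0 ≤ ξ) :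
    (approxPoly p ξ).eval 1 = 1 := by
  rw [approxPoly, eval_mul, eval_C, inv_mul_cancel₀ (eval_one_displaced_ne_zero hp hξ)]

lemma tendsto_coeff_approxPoly {p : ℂ[X]} (hp : p.eval 1 = 1) (n : ℕ) :
    Tendsto (fun ξ : ℝ => (approxPoly p ξ).coeff n) (𝓝 0) (𝓝 (p.coeff n)) := by
  conv_rhs => rw [← approxPoly_zero hp]
  simp only [approxPoly, coeff_C_mul]
  exact (((continuous_eval_displaced p 1).tendsto 0).inv₀
    (eval_one_displaced_ne_zero (by simp [hp]) le_rfl)).mul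
      ((continuous_coeff_displaced p n).tendsto 0)

/-- Supplies the support bound that is uniform in `ξ`. -/
lemma natDegree_approxPoly_le (p : ℂ[X]) (ξ : ℝ) : (approxPoly p ξ).natDegree ≤ p.natDegree := by
  refine (natDegree_C_mul_le _ _).trans ?_
  have : (displaced p ξ).natDegree = p.roots.card := by
    have := natDegree_multiset_prod_X_sub_C_eq_card
      (p.roots.map fun r : ℂ => if ‖r‖ = 1 then (1 + (ξ : ℂ)) * r else r)
    rwa [Multiset.map_map, Multiset.card_map] at this
  exact this ▸ card_roots' p

lemma abs_le_shiftExp {a : ℤ →₀ ℝ} {k : ℤ} (hk : k ∈ a.support) : |k| ≤ shiftExp a := by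
  have : k.natAbs ≤ shiftExp a := Finset.le_sup (f := Int.natAbs) hk
  rw [Int.abs_eq_natAbs]
  exact_mod_cast this

lemma coeff_symbolPoly (a : ℤ →₀ ℝ) (n : ℕ) : (symbolPoly a).coeff n = a (n - shiftExp a) := by
  rw [symbolPoly, finsetSum_coeff, Finset.sum_eq_single ((n : ℤ) - shiftExp a)]
  · rw [coeff_monomial, if_pos (by omega)]
  · intro k hk hne
    have := abs_le.1 (abs_le_shiftExp hk)
    rw [coeff_monomial, if_neg (by omega)]
  · intro h
    rw [Finsupp.notMem_support_iff.1 h, monomial_zero_right, coeff_zero]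

lemma eval_one_symbolPoly (a : ℤ →₀ ℝ) : (symbolPoly a).eval 1 = ∑ᶠ k, a k := by
  rw [symbolPoly, eval_finsetSum, finsum_eq_sum_of_support_subset (s := a.support)]
  · simp
  · simp

lemma tendsto_approxCoeff {a : ℤ →₀ ℝ} (h : ∑ᶠ k, a k = 1) (k : ℤ) :
    Tendsto (fun ξ : ℝ => (approxCoeff a ξ k).re) (𝓝 0) (𝓝 (a k)) := by
  unfold approxCoeff
  have hp : ((symbolPoly a).map (algebraMap ℝ ℂ)).eval 1 = 1 := by
    rw [eval_one_map, eval_one_symbolPoly, h, map_one]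
  split_ifs with hk
  · have := (Complex.continuous_re.tendsto _).comp
      (tendsto_coeff_approxPoly hp (k + shiftExp a).toNat)
    rw [coeff_map, coeff_symbolPoly, Int.toNat_of_nonneg hk, add_sub_cancel_right] at this
    simpa [Function.comp_def] using this
  · have : a k = 0 := by
      by_contra h0
      have := abs_le.1 (abs_le_shiftExp (Finsupp.mem_support_iff.2 h0))
      omega
    simp [this]

lemma le_of_approxCoeff_ne_zero {a : ℤ →₀ ℝ} {ξ : ℝ} {k : ℤ} (h : approxCoeff a ξ k ≠ 0) :
    0 ≤ k + shiftExp a ∧ k + shiftExp a ≤ (symbolPoly a).natDegree := by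
  unfold approxCoeff at h
  split_ifs at h with hk
  · have h1 := le_natDegree_of_ne_zero h
    have h2 := natDegree_approxPoly_le ((symbolPoly a).map (algebraMap ℝ ℂ)) ξ
    rw [natDegree_map] at h2
    omega
  · exact absurd rfl h

lemma finsum_approxCoeff {a : ℤ →₀ ℝ} (h : ∑ᶠ k, a k = 1) {ξ : ℝ} (hξ : 0 ≤ ξ) :
    ∑ᶠ k, (approxCoeff a ξ k).re = 1 := by
  have hp : ((symbolPoly a).map (algebraMap ℝ ℂ)).eval 1 = 1 := by
    rw [eval_one_map, eval_one_symbolPoly, h, map_one]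
  have he := eval_one_approxPoly (by simp [hp]) hξ (p := (symbolPoly a).map (algebraMap ℝ ℂ))
  have hdeg := natDegree_approxPoly_le ((symbolPoly a).map (algebraMap ℝ ℂ)) ξ
  rw [natDegree_map] at hdeg
  rw [eval_eq_sum_range' (Nat.lt_succ_of_le hdeg)] at he
  simp only [one_pow, mul_one] at he
  rw [finsum_eq_sum_of_support_subset (s := (Finset.range ((symbolPoly a).natDegree + 1)).image
    fun n : ℕ => (n : ℤ) - shiftExp a), Finset.sum_image]
  · rw [← Complex.one_re, ← he, Complex.re_sum]
    refine Finset.sum_congr rfl fun n _ => ?_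
    rw [approxCoeff, sub_add_cancel, if_pos (by positivity), Int.toNat_natCast]
  · intro x _ y _ hxy
    simpa using hxy
  · intro k hk
    have := le_of_approxCoeff_ne_zero (a := a) (ξ := ξ) (k := k) fun h0 => hk (by simp [h0])
    rw [Finset.coe_image]
    exact ⟨(k + shiftExp a).toNat, by simp; omega, by dsimp only; omega⟩

lemma approxMask_apply (α : ℤ →₀ ℝ) (ξ : ℝ) (j : ℤ) : approxMask α ξ j =
    if Even j then (approxCoeff (evenPart α) ξ (j / 2)).re else α j := rfl

lemma subdivide_one_even (β : ℤ →₀ ℝ) (m : ℤ) : subdivide β 1 (2 * m) = ∑ᶠ k, β (2 * k) := by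
  simp only [subdivide, Pi.one_apply, mul_one, ← mul_sub]
  exact finsum_comp_equiv (Equiv.subLeft m) (f := fun k => β (2 * k))

lemma finsum_evenPart {α : ℤ →₀ ℝ} (h : subdivide α 1 = 1) : ∑ᶠ k, evenPart α k = 1 := by
  have := subdivide_one_even α 0
  rw [h] at this
  exact this.symm

/-- At even indices this is the normalization at `1`; at odd indices the mask entries are those of
`α`. -/
lemma subdivide_approxMask_one {α : ℤ →₀ ℝ} (h : subdivide α 1 = 1) {ξ : ℝ} (hξ : 0 ≤ ξ) :
    subdivide (approxMask α ξ) 1 = 1 := by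
  ext j
  rcases Int.even_or_odd' j with ⟨m, rfl | rfl⟩
  · rw [subdivide_one_even, Pi.one_apply, ← finsum_approxCoeff (finsum_evenPart h) hξ]
    refine finsum_congr fun k => ?_
    rw [approxMask_apply, if_pos (even_two_mul k), Int.mul_ediv_cancel_left _ two_ne_zero]
  · rw [← congrFun h (2 * m + 1)]
    refine finsum_congr fun k => ?_
    rw [approxMask_apply, if_neg]
    rw [Int.even_iff]
    omega

lemma tendsto_approxMask {α : ℤ →₀ ℝ} (h : subdivide α 1 = 1) (j : ℤ) :
    Tendsto (fun ξ : ℝ => approxMask α ξ j) (𝓝 0) (𝓝 (α j)) := by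
  simp only [approxMask_apply]
  split_ifs with hj
  · obtain ⟨m, rfl⟩ := even_iff_two_dvd.1 hj
    rw [Int.mul_ediv_cancel_left _ two_ne_zero]
    exact tendsto_approxCoeff (finsum_evenPart h) m
  · exact tendsto_const_nhds

lemma exists_support_bound_approxMask (α : ℤ →₀ ℝ) :
    ∃ N : ℕ, (∀ ξ i, approxMask α ξ i ≠ 0 → |i| ≤ N) ∧ ∀ i, α i ≠ 0 → |i| ≤ N := by
  obtain ⟨N, hN⟩ := exists_support_bound α
  set s := shiftExp (evenPart α)
  set d := (symbolPoly (evenPart α)).natDegree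
  refine ⟨N + 2 * s + 2 * d + 1, fun ξ i hi => ?_, fun i hi => (hN i hi).trans ?_⟩
  · rw [approxMask_apply] at hi
    split_ifs at hi with he
    · have := le_of_approxCoeff_ne_zero (a := evenPart α) (ξ := ξ) (k := i / 2)
        fun h0 => hi (by simp [h0])
      rw [abs_le]
      omega
    · exact (hN i hi).trans (by omega)
  · omega

end Subdivision

open Filter Topology in
theorem mainTheorem9 (α : ℤ →₀ ℝ) (hα : Subdivision.IsConvergent α) :
    ∃ ξ₀ : ℝ, 0 < ξ₀ ∧ ∀ ξ : ℝ, 0 < ξ → ξ < ξ₀ →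
      Subdivision.IsConvergent (Subdivision.approxMask α ξ) := by
  obtain ⟨c, f, hf, h0⟩ := hα.2
  have h1 := hf.subdivide_one h0
  obtain ⟨N, hN, hNα⟩ := Subdivision.exists_support_bound_approxMask α
  -- The filter is one-sided because reproduction of constants is established only for `ξ ≥ 0`.
  have hev : ∀ᶠ ξ in 𝓝[>] (0 : ℝ), Subdivision.IsConvergent (Subdivision.approxMask α ξ) :=
    hα.eventually hN hNα
      (fun i => (Subdivision.tendsto_approxMask h1 i).mono_left nhdsWithin_le_nhds)
      (eventually_mem_nhdsWithin.mono fun ξ hξ =>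
        Subdivision.subdivide_approxMask_one h1 (le_of_lt hξ))
  obtain ⟨ξ₀, hξ₀, h⟩ := mem_nhdsGT_iff_exists_Ioo_subset.1 hev
  exact ⟨ξ₀, hξ₀, fun ξ hξ hξ' => h ⟨hξ, hξ'⟩⟩
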